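/- (In ZFC.) For a topological space $X$: * a subset $S\subseteq X$ is *free* if it has a well-ordering $\prec$ such that $\overline{\{a\in S: a\prec b\}}\cap\overline{\{a\in S: a\not\prec b\}}=\emptyset$ for every $b\in S$; $F(X)$ is the supremum of the cardinalities of the free subsets of $X$; * $w(X)$ is the least cardinality of a base of $X$; * a Hausdorff space $X$ is *strongly anti-Urysohn* (SAU) if it has at least two non-isolated points and any two infinite closed subsets of $X$ intersect; * $X_r$ is the set $X$ with the topology generated by the regular open subsets of $X$, i.e. the sets $U\subseteq X$ with $U=\operatorname{Int}\overline{U}$. Let $\mathfrak c=2^{\aleph_0}$. **Theorem.** There is a separable Hausdorff SAU space $X$ of cardinality $2^{\mathfrak c}$ such that $X_r$ is a Hausdorff SAU space with $F(X_r)=\omega$, $w(X_r)\le\mathfrak c$ and $|X_r|=2^{\mathfrak c}$. In particular $|X_r|>w(X_r)^{\omega}$; so the inequality $|Z|\le w(Z)^{\omega}$, which PFA implies for all regular Hausdorff spaces $Z$ with $F(Z)=\omega$, can fail, in ZFC, for a Hausdorff space $Z$ with $F(Z)=\omega$. -/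

import Mathlib

open scoped Cardinal

/-- A subset `S` of a space is free if it carries a well-ordering that turns it into a free
sequence: for every element `b` of `S`, the closure of the set of predecessors of `b` is disjoint
from the closure of the rest of `S` (that is, of `b` and its successors). -/
def IsFreeSet {X : Type*} [TopologicalSpace X] (S : Set X) : Prop :=
  ∃ r : S → S → Prop, IsWellOrder S r ∧
    ∀ b : S, closure (Subtype.val '' {a : S | r a b}) ∩
      closure (Subtype.val '' {a : S | ¬ r a b}) = ∅

/-- The free set number `F(X)`: the supremum of the cardinalities of the free subsets of `X`.
The set of these cardinalities is bounded by the cardinality of `X`. -/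
noncomputable def freeSetNumber (X : Type*) [TopologicalSpace X] : Cardinal :=
  sSup {κ | ∃ S : Set X, IsFreeSet S ∧ κ = #S}

/-- The weight `w(X)`: the least cardinality of a base of `X`. -/
noncomputable def spaceWeight (X : Type*) [TopologicalSpace X] : Cardinal :=
  sInf {κ | ∃ B : Set (Set X), TopologicalSpace.IsTopologicalBasis B ∧ κ = #B}

/-- The strongly anti-Urysohn property (for Hausdorff spaces): there are at least two non-isolated
points, and any two infinite closed sets intersect. -/
structure IsStronglyAntiUrysohn (X : Type*) [TopologicalSpace X] : Prop where
  two_nonisolated : ∃ x y : X, x ≠ y ∧ ¬ IsOpen {x} ∧ ¬ IsOpen {y}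
  inter_nonempty : ∀ E F : Set X, IsClosed E → IsClosed F → E.Infinite → F.Infinite →
    (E ∩ F).Nonempty

/-- The regular-open topology of `X`, generated by the regular open sets of `X`, those `U` that
equal the interior of their closure in `X`. -/
abbrev regularOpenTopology (X : Type*) [TopologicalSpace X] : TopologicalSpace X :=
  TopologicalSpace.generateFrom {U : Set X | interior (closure U) = U}

/-- The space `X_r`: the underlying set of `X`, carrying the regular-open topology of `X`. -/
def RegularOpenSpace (X : Type*) : Type _ := X

instance RegularOpenSpace.instTopologicalSpace (X : Type*) [TopologicalSpace X] :
    TopologicalSpace (RegularOpenSpace X) :=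
  regularOpenTopology X

/-! The space is a free construction. Its points are well-founded trees over a countable set of
isolated leaves; a node carries one of `2 ^ 𝔠` labels and two injective sequences of earlier trees,
and it is declared a limit of each sequence along an ultrafilter. Two infinite closed sets contain
injective sequences, and a node joining these two sequences lies in both sets. Every nonempty open
set reaches a leaf by descending through a tree, so the leaves are dense.

The difficulty is the Hausdorff property. It holds if the ultrafilters are pairwise Rudin–Keisler
inequivalent weak P-points: any countably many of their images under injections then have disjoint
members (`exists_pairwise_disjoint_mem_map`), and two points are separated by their sets of
descendants in a countable forest (`t2Space_branchTopology`). Enough weak P-points are obtained by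
Kunen's method, a transfinite construction of filters that spends an independent linked family of
size `𝔠`, keeping part of the family to code `2 ^ 𝔠` different outcomes.

Passing to the regular open topology keeps the anti-Urysohn property, since it has fewer closed
sets, and keeps disjoint open sets separable. A regular open set is determined by its trace on a
countable dense set, so the weight drops to at most `𝔠`. In a free set one of each initial segment
and its complement is finite, so free sets are countable. Finally `𝔠 ^ ℵ₀ = 𝔠 < 2 ^ 𝔠`. -/

open Filter Set

/-! ### Filters that keep a linked family independent -/

section Independence

variable {I J S : Type}

/-- The points that lie in `A i j n` for all `i ∈ t` and `j ∈ s i`, where `n` is the number of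
elements of `s i`. -/
def linkedCell (A : I → J → ℕ → Set S) (t : Finset I) (s : I → Finset J) : Set S :=
  {x | ∀ i ∈ t, ∀ j ∈ s i, x ∈ A i j (s i).card}

/-- The part of the family `A` with indices in `K` is independent linked modulo the filter `F`. -/
def IndependentOn (A : I → J → ℕ → Set S) (K : Set I) (F : Filter S) : Prop :=
  ∀ t : Finset I, ↑t ⊆ K → ∀ s : I → Finset J, ∃ᶠ x in F, x ∈ linkedCell A t s

variable {A : I → J → ℕ → Set S} {K L : Set I} {F G : Filter S}

theorem IndependentOn.mono (h : IndependentOn A K F) (hL : L ⊆ K) : IndependentOn A L F :=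
  fun t ht s => h t (ht.trans hL) s

/-- A failure of independence is a single set belonging to the filter, and membership in a directed
infimum is already witnessed by one of its terms. This carries limit stages. -/
theorem IndependentOn.iInf {ι : Type*} [Nonempty ι] {f : ι → Filter S}
    (hf : Directed (· ≥ ·) f) (h : ∀ k, IndependentOn A K (f k)) :
    IndependentOn A K (⨅ k, f k) := by
  intro t ht s hx
  obtain ⟨k, hk⟩ := (mem_iInf_of_directed hf _).1 hx
  exact h k t ht s hk

theorem IndependentOn.inf_linkedCell (h : IndependentOn A K F) {t : Finset I} (ht : ↑t ⊆ K)
    (s : I → Finset J) : IndependentOn A (K \ t) (F ⊓ 𝓟 (linkedCell A t s)) := by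
  classical
  intro t' ht' s'
  rw [frequently_inf_principal]
  refine (h (t ∪ t') ?_ (fun i => if i ∈ t then s i else s' i)).mono ?_
  · rw [Finset.coe_union]
    exact union_subset ht fun i hi => (ht' hi).1
  · intro x hx
    constructor
    · intro i hi j hj
      have := hx i (Finset.mem_union_left _ hi) j
      simp only [if_pos hi] at this
      exact this hj
    · intro i hi j hj
      have := hx i (Finset.mem_union_right _ hi) j
      have hn : i ∉ t := fun h' => (ht' hi).2 h'
      simp only [if_neg hn] at this
      exact this hj

theorem IndependentOn.inf_principal (h : IndependentOn A K F) {t : Finset I} (ht : ↑t ⊆ K)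
    (s : I → Finset J) {B : Set S} (hB : ∀ᶠ x in F, x ∈ linkedCell A t s → x ∈ B) :
    IndependentOn A (K \ t) (F ⊓ 𝓟 B) := by
  intro t' ht' s'
  have := h.inf_linkedCell ht s t' ht' s'
  rw [frequently_inf_principal] at this ⊢
  exact (this.and_eventually hB).mono fun x hx => ⟨hx.2 hx.1.1, hx.1.2⟩

/-- The points that lie in `A i j n` whenever `U n` is the first member of the sequence `U` which
they miss. -/
def firstMissSet (A : I → J → ℕ → Set S) (i : I) (U : ℕ → Set S) (j : J) : Set S :=
  {x | ∀ n, (∀ m < n, x ∈ U m) → x ∉ U n → x ∈ A i j n}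

/-- The requirement on a filter coming from the sequence `U`: it decides that the members of `U`
are not all in it, or it contains the sets `firstMissSet A i U j` for some `i`. -/
def Settles (A : I → J → ℕ → Set S) (F : Filter S) (U : ℕ → Set S) : Prop :=
  (∃ n, {x | ∀ m < n, x ∈ U m}ᶜ ∈ F) ∨ ∃ i, ∀ j, firstMissSet A i U j ∈ F

theorem Settles.mono {U : ℕ → Set S} (h : Settles A F U) (hG : G ≤ F) : Settles A G U := by
  rcases h with ⟨n, hn⟩ | ⟨i, hi⟩
  · exact Or.inl ⟨n, hG hn⟩
  · exact Or.inr ⟨i, fun j => hG (hi j)⟩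

/-- If adding all finite intersections of `U` preserves independence, one index `i` pays for adding
the sets `firstMissSet A i U j`. Otherwise some cell is disjoint from a finite intersection modulo
`F`, and adding that cell costs its finitely many indices. -/
theorem IndependentOn.exists_settles (hA : ∀ i j, Monotone (A i j)) (h : IndependentOn A K F)
    (hK : K.Nonempty) (U : ℕ → Set S) :
    ∃ p : Filter S × Finset I, p.1 ≤ F ∧ IndependentOn A (K \ p.2) p.1 ∧ Settles A p.1 U := by
  classical
  by_cases hU : ∀ n, IndependentOn A K (F ⊓ 𝓟 {x | ∀ m < n, x ∈ U m})
  · obtain ⟨i, hi⟩ := hK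
    have hG : IndependentOn A K (⨅ n, F ⊓ 𝓟 {x | ∀ m < n, x ∈ U m}) := by
      refine IndependentOn.iInf (Antitone.directed_ge ?_) hU
      intro a b hab
      refine inf_le_inf_left _ (principal_mono.2 fun x hx m hm => hx m (hm.trans_le hab))
    set G := ⨅ n, F ⊓ 𝓟 {x | ∀ m < n, x ∈ U m} with hGdef
    have hGF : G ≤ F := (iInf_le _ 0).trans inf_le_left
    have hGU : ∀ n, {x | ∀ m < n, x ∈ U m} ∈ G := fun n =>
      (iInf_le _ n : G ≤ _) (mem_inf_of_right (mem_principal_self _))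
    refine ⟨(⨅ s : Finset J, G ⊓ 𝓟 {x | ∀ j ∈ s, x ∈ firstMissSet A i U j}, {i}),
      (iInf_le _ ∅).trans (inf_le_left.trans hGF), ?_, Or.inr ⟨i, fun j => ?_⟩⟩
    · refine IndependentOn.iInf (Antitone.directed_ge ?_) fun s => ?_
      · intro a b hab
        exact inf_le_inf_left _ (principal_mono.2 fun x hx j hj => hx j (hab hj))
      · refine hG.inf_principal (by simpa using hi) (fun _ => s) ?_
        -- Modulo `G` a first miss cannot occur before `s.card`, so monotonicity moves membership
        -- from level `s.card` to the level of the miss.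
        filter_upwards [hGU s.card] with x hx hc j hj n hn hxn
        refine hA i j ?_ (hc i (by simp) j hj)
        by_contra hlt
        exact hxn (hx n (not_le.1 hlt))
    · refine mem_iInf_of_mem {j} (mem_inf_of_right ?_)
      intro x hx
      exact hx j (by simp)
  · simp only [IndependentOn, not_forall] at hU
    obtain ⟨n, t, ht, s, hs⟩ := hU
    rw [frequently_inf_principal, not_frequently] at hs
    refine ⟨(F ⊓ 𝓟 (linkedCell A t s), t), inf_le_left, h.inf_linkedCell ht s,
      Or.inl ⟨n, ?_⟩⟩
    rw [mem_inf_principal]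
    filter_upwards [hs] with x hx hc hxU using hx ⟨hxU, hc⟩

end Independence

/-! ### Settling a well-ordered list of sequences -/

section Recursion

variable {I J S : Type} (A : I → J → ℕ → Set S)

open Classical in
/-- One step of the recursion: from a filter and a set of indices for which the family is
independent, to a smaller filter that settles `U` and the finite set of indices spent on it. -/
noncomputable def settleStep (F : Filter S) (K : Set I) (U : ℕ → Set S) : Filter S × Finset I :=
  if h : ∃ p : Filter S × Finset I, p.1 ≤ F ∧ IndependentOn A (K \ p.2) p.1 ∧ Settles A p.1 U
  then h.choose else (F, ∅)

variable {A} in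
theorem settleStep_spec (hA : ∀ i j, Monotone (A i j)) {F : Filter S} {K : Set I}
    (h : IndependentOn A K F) (hK : K.Nonempty) (U : ℕ → Set S) :
    (settleStep A F K U).1 ≤ F ∧
      IndependentOn A (K \ (settleStep A F K U).2) (settleStep A F K U).1 ∧
      Settles A (settleStep A F K U).1 U := by
  have := h.exists_settles hA hK U
  rw [settleStep, dif_pos this]
  exact this.choose_spec

variable {τ : Type} [LinearOrder τ] [WellFoundedLT τ] (F : Filter S) (K : Set I)
  (U : τ → ℕ → Set S)

/-- The transfinite iteration of `settleStep` along a well-ordered list of sequences. -/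
noncomputable def settleRec : τ → Filter S × Finset I :=
  wellFounded_lt.fix fun a ih =>
    settleStep A (F ⊓ ⨅ b : Iio a, (ih b b.2).1) (K \ ⋃ b : Iio a, ((ih b b.2).2 : Set I)) (U a)

theorem settleRec_eq (a : τ) : settleRec A F K U a =
    settleStep A (F ⊓ ⨅ b : Iio a, (settleRec A F K U b).1)
      (K \ ⋃ b : Iio a, ((settleRec A F K U b).2 : Set I)) (U a) :=
  wellFounded_lt.fix_eq _ a

variable {A F K}

theorem settleRec_spec (hA : ∀ i j, Monotone (A i j)) (h : IndependentOn A K F)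
    (hK : ∀ (t : τ → Finset I) (a : τ), (K \ ⋃ b : Iio a, (t b : Set I)).Nonempty) (a : τ) :
    (settleRec A F K U a).1 ≤ F ⊓ ⨅ b : Iio a, (settleRec A F K U b).1 ∧
      IndependentOn A (K \ ⋃ b : Iic a, ((settleRec A F K U b).2 : Set I))
        (settleRec A F K U a).1 ∧
      Settles A (settleRec A F K U a).1 (U a) := by
  induction a using WellFoundedLT.induction with
  | ind a ih =>
  have hle : ∀ b < a, ∀ c < b, (settleRec A F K U b).1 ≤ (settleRec A F K U c).1 :=
    fun b hb c hc => (ih b hb).1.trans (inf_le_right.trans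
      (iInf_le (fun c : Iio b => (settleRec A F K U c).1) ⟨c, hc⟩))
  have hind : IndependentOn A (K \ ⋃ b : Iio a, ((settleRec A F K U b).2 : Set I))
      (F ⊓ ⨅ b : Iio a, (settleRec A F K U b).1) := by
    rcases isEmpty_or_nonempty (Iio a) with he | he
    · have hF : F ⊓ ⨅ b : Iio a, (settleRec A F K U b).1 = F := by simp [iInf_of_empty]
      rw [hF]
      exact h.mono sdiff_subset
    · have : (⨅ b : Iio a, (settleRec A F K U b).1) ≤ F := by
        obtain ⟨b⟩ := he
        exact (iInf_le _ b).trans ((ih b b.2).1.trans inf_le_left)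
      rw [inf_eq_right.2 this]
      refine IndependentOn.iInf (Antitone.directed_ge ?_) fun b => ?_
      · intro b c hbc
        rcases hbc.eq_or_lt with rfl | hlt
        · exact le_rfl
        · exact hle c c.2 b hlt
      · refine (ih b b.2).2.1.mono (sdiff_subset_sdiff_right ?_)
        refine iUnion_subset fun c => ?_
        exact subset_iUnion (fun c : Iio a => ((settleRec A F K U c).2 : Set I))
          ⟨c, lt_of_le_of_lt c.2 b.2⟩
  have := settleStep_spec hA hind (hK (fun b => (settleRec A F K U b).2) a) (U a)
  rw [← settleRec_eq] at this
  refine ⟨this.1, this.2.1.mono ?_, this.2.2⟩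
  rintro i ⟨hiK, hi⟩
  simp only [mem_iUnion, not_exists] at hi
  refine ⟨⟨hiK, ?_⟩, hi ⟨a, le_rfl⟩⟩
  simp only [mem_iUnion, not_exists]
  exact fun b => hi ⟨b, le_of_lt b.2⟩

theorem exists_filter_settles (hA : ∀ i j, Monotone (A i j)) (h : IndependentOn A K F)
    (hK : ∀ (t : τ → Finset I) (a : τ), (K \ ⋃ b : Iio a, (t b : Set I)).Nonempty) :
    ∃ G : Filter S, G.NeBot ∧ G ≤ F ∧ ∀ a, Settles A G (U a) := by
  have key := settleRec_spec U hA h hK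
  rcases isEmpty_or_nonempty τ with he | he
  · refine ⟨F, ?_, le_rfl, fun a => he.elim a⟩
    exact ⟨fun hF => by
      have := h ∅ (by simp) (fun _ => ∅)
      simp [hF] at this⟩
  · refine ⟨⨅ a, (settleRec A F K U a).1, ?_, ?_, fun a => (key a).2.2.mono (iInf_le _ a)⟩
    · have : IndependentOn A ∅ (⨅ a, (settleRec A F K U a).1) := by
        refine IndependentOn.iInf (Antitone.directed_ge ?_)
          fun a => (key a).2.1.mono (empty_subset _)
        intro b c hbc
        rcases hbc.eq_or_lt with rfl | hlt
        · exact le_rfl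
        · exact (key c).1.trans (inf_le_right.trans
            (iInf_le (fun b : Iio c => (settleRec A F K U b).1) ⟨b, hlt⟩))
      exact ⟨fun hF => by
        have := this ∅ (by simp) (fun _ => ∅)
        simp [hF] at this⟩
    · obtain ⟨a⟩ := he
      exact (iInf_le _ a).trans ((key a).1.trans inf_le_left)

end Recursion

/-! ### Existence of weak P-points -/

/-- A weak P-point: a free ultrafilter that is not in the closure of any countable set of other
free ultrafilters. -/
def IsWeakPPoint {S : Type} (p : Ultrafilter S) : Prop :=
  (p : Filter S) ≤ cofinite ∧ ∀ Q : Set (Ultrafilter S), Q.Countable →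
    (∀ q ∈ Q, q ≠ p ∧ (q : Filter S) ≤ cofinite) → ∃ E ∈ p, ∀ q ∈ Q, E ∉ q

/-- Let `U n` be in `p` but not in `q n`. If `m` is least with `U m ∉ q n`, then `q n` concentrates
on points first missing `U m`, so `m + 1` of the sets `firstMissSet A i U j` in `q n` would put a
finite set in `q n`. Each `q n` thus contains only finitely many of them, and uncountability of `J`
leaves a `j` whose set avoids every `q n`. -/
theorem isWeakPPoint_of_settles {I J S : Type} [Uncountable J] {A : I → J → ℕ → Set S}
    (hA : ∀ i n (s : Finset J), n < s.card → {x | ∀ j ∈ s, x ∈ A i j n}.Finite)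
    {p : Ultrafilter S} (hp : (p : Filter S) ≤ cofinite) (h : ∀ U, Settles A p U) :
    IsWeakPPoint p := by
  refine ⟨hp, fun Q hQ hQp => ?_⟩
  rcases Q.eq_empty_or_nonempty with rfl | hne
  · exact ⟨univ, univ_mem, by simp⟩
  obtain ⟨q, rfl⟩ := hQ.exists_eq_range hne
  have hU : ∀ n, ∃ E ∈ p, E ∉ q n := by
    intro n
    by_contra! hc
    exact (hQp (q n) ⟨n, rfl⟩).1 (Ultrafilter.coe_le_coe.1 hc)
  choose U hUp hUq using hU
  obtain ⟨i, hi⟩ : ∃ i, ∀ j, firstMissSet A i U j ∈ p := by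
    rcases h U with ⟨n, hn⟩ | hi
    · refine absurd hn (Ultrafilter.compl_mem_iff_notMem.not.2 (not_not.2 ?_))
      have : {x | ∀ m < n, x ∈ U m} = ⋂ m ∈ Iio n, U m := by ext; simp
      rw [this]
      exact (biInter_mem (finite_Iio n)).2 fun m _ => hUp m
    · exact hi
  have hfin : ∀ n, {j | firstMissSet A i U j ∈ q n}.Finite := by
    classical
    intro n
    have hex : ∃ m, U m ∉ q n := ⟨n, hUq n⟩
    by_contra hinf
    obtain ⟨s, hs, hcard⟩ := Set.Infinite.exists_subset_card_eq hinf (Nat.find hex + 1)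
    have h1 : {x | ∀ m < Nat.find hex, x ∈ U m} ∈ q n := by
      have : {x | ∀ m < Nat.find hex, x ∈ U m} = ⋂ m ∈ Iio (Nat.find hex), U m := by ext; simp
      rw [this]
      refine (biInter_mem (finite_Iio _)).2 fun m hm => ?_
      exact not_not.1 (Nat.find_min hex hm)
    have h2 : (U (Nat.find hex))ᶜ ∈ q n :=
      Ultrafilter.compl_mem_iff_notMem.2 (Nat.find_spec hex)
    have h3 : (⋂ j ∈ s, firstMissSet A i U j) ∈ q n :=
      (biInter_finset_mem s).2 fun j hj => hs hj
    have hF := hA i (Nat.find hex) s (by omega)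
    have h4 : {x | ∀ j ∈ s, x ∈ A i j (Nat.find hex)} ∈ q n := by
      filter_upwards [h1, h2, h3] with x hx1 hx2 hx3 j hj
      exact mem_iInter₂.1 hx3 j hj _ hx1 hx2
    have h5 := (hQp (q n) ⟨n, rfl⟩).2 hF.compl_mem_cofinite
    exact Ultrafilter.compl_notMem_iff.2 h4 h5
  obtain ⟨j, hj⟩ : ∃ j, j ∉ ⋃ n, {j | firstMissSet A i U j ∈ q n} := by
    by_contra! hc
    exact not_countable_univ ((countable_iUnion fun n => (hfin n).countable).mono
      fun j _ => hc j)
  refine ⟨_, hi j, ?_⟩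
  rintro _ ⟨n, rfl⟩ hn
  exact hj (mem_iUnion.2 ⟨n, hn⟩)

theorem IndependentOn.exists_isWeakPPoint {I J S : Type} [Countable S] [Uncountable J]
    {A : I → J → ℕ → Set S} (hmono : ∀ i j, Monotone (A i j))
    (hA : ∀ i n (s : Finset J), n < s.card → {x | ∀ j ∈ s, x ∈ A i j n}.Finite)
    {K : Set I} (hK : 𝔠 ≤ #K) {F : Filter S} (hF : F ≤ cofinite) (h : IndependentOn A K F) :
    ∃ p : Ultrafilter S, (p : Filter S) ≤ F ∧ IsWeakPPoint p := by
  have hτ : #(ℕ → Set S) ≤ 𝔠 := by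
    simp only [Cardinal.mk_pi, Cardinal.mk_set, Cardinal.prod_const, Cardinal.mk_nat,
      Cardinal.lift_id]
    calc ((2 : Cardinal) ^ #S) ^ ℵ₀ ≤ (2 ^ ℵ₀) ^ ℵ₀ :=
          Cardinal.power_le_power_right
            (Cardinal.power_le_power_left two_ne_zero (Cardinal.mk_le_aleph0))
      _ = 𝔠 := by simp
  let τ := (#(ℕ → Set S)).ord.ToType
  obtain ⟨e⟩ : Nonempty (τ ≃ (ℕ → Set S)) := Cardinal.eq.1 (Cardinal.mk_ord_toType _)
  obtain ⟨G, hG, hGF, hset⟩ := exists_filter_settles (τ := τ) (fun a => e a) hmono h (by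
    -- Fewer than `𝔠` stages precede `a`, each spending finitely many indices, so `K` is not
    -- exhausted.
    intro t a
    by_contra hne
    rw [not_nonempty_iff_eq_empty, sdiff_eq_empty] at hne
    have h1 : #(Iio a) < 𝔠 := (Cardinal.mk_Iio_lt a (by simp [τ])).trans_le
      ((Cardinal.mk_ord_toType _).trans_le hτ)
    have h2 : #(⋃ b : Iio a, (t b : Set I)) < 𝔠 := by
      refine (Cardinal.mk_iUnion_le_sum_mk).trans_lt ?_
      refine (Cardinal.sum_le_sum _ (fun _ => ℵ₀) fun b => Cardinal.mk_le_aleph0).trans_lt ?_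
      rw [Cardinal.sum_const']
      exact Cardinal.mul_lt_of_lt Cardinal.aleph0_le_continuum h1 Cardinal.aleph0_lt_continuum
    exact absurd (hK.trans (Cardinal.mk_le_mk_of_subset hne)) (not_le.2 h2))
  refine ⟨Ultrafilter.of G, (Ultrafilter.of_le G).trans hGF, ?_⟩
  refine isWeakPPoint_of_settles hA ((Ultrafilter.of_le G).trans (hGF.trans hF)) fun U => ?_
  simpa using (hset (e.symm U)).mono (Ultrafilter.of_le G)

/-! ### An independent linked family on a countable set -/

section LinkedFamily

/-- The countable set that carries the independent linked family: pairs of a natural number `k` and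
a binary relation on the subsets of `Fin k`. -/
abbrev FiniteRelation : Type := Σ k : ℕ, Finset (Finset (Fin k) × Finset (Fin k))

open Classical in
/-- The trace on `Fin k` of a set of natural numbers. -/
noncomputable def finTrace (X : Set ℕ) (k : ℕ) : Finset (Fin k) :=
  Finset.univ.filter fun m => (m : ℕ) ∈ X

theorem eventually_injOn_finTrace (s : Finset (Set ℕ)) :
    ∀ᶠ k in atTop, InjOn (fun X => finTrace X k) (s : Set (Set ℕ)) := by
  have : ∀ X ∈ s, ∀ Y ∈ s, ∀ᶠ k in atTop, finTrace X k = finTrace Y k → X = Y := by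
    intro X _ Y _
    by_cases hXY : X = Y
    · exact Eventually.of_forall fun _ _ => hXY
    · obtain ⟨m, hm⟩ : ∃ m, ¬(m ∈ X ↔ m ∈ Y) := by
        by_contra! hc
        exact hXY (Set.ext hc)
      filter_upwards [eventually_gt_atTop m] with k hk h
      have := Finset.ext_iff.1 h ⟨m, hk⟩
      simp [finTrace] at this
      exact absurd this hm
  simp only [← Finset.eventually_all] at this
  filter_upwards [this] with k hk X hX Y hY h using hk X hX Y hY h

variable {I : Type} (e : I → Set ℕ)

open Classical in
/-- The family of all relations in which the trace of `e i` is related to the trace of `Y` and to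
at most `n` sets altogether. -/
def linkedFamily (i : I) (Y : Set ℕ) (n : ℕ) : Set FiniteRelation :=
  {x | (x.2.filter fun y => y.1 = finTrace (e i) x.1).card ≤ n ∧
    (finTrace (e i) x.1, finTrace Y x.1) ∈ x.2}

theorem monotone_linkedFamily (i : I) (Y : Set ℕ) : Monotone (linkedFamily e i Y) :=
  fun _ _ h _ hx => ⟨hx.1.trans h, hx.2⟩

/-- For large `k` the members of `s` have distinct traces on `Fin k`, which are too many partners
for the trace of `e i`. -/
theorem finite_linkedFamily (i : I) (n : ℕ) (s : Finset (Set ℕ)) (hs : n < s.card) :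
    {x | ∀ Y ∈ s, x ∈ linkedFamily e i Y n}.Finite := by
  classical
  obtain ⟨k₀, hk₀⟩ := eventually_atTop.1 (eventually_injOn_finTrace s)
  have hfin : (⋃ k ∈ Iio k₀, range
      (Sigma.mk (β := fun k => Finset (Finset (Fin k) × Finset (Fin k))) k)).Finite :=
    (finite_Iio k₀).biUnion fun k _ => finite_range _
  refine hfin.subset ?_
  rintro ⟨k, R⟩ hx
  simp only [mem_iUnion, mem_Iio]
  refine ⟨k, ?_, R, rfl⟩
  by_contra hk
  have hsub : s.image (fun Y => (finTrace (e i) k, finTrace Y k)) ⊆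
      R.filter fun y => y.1 = finTrace (e i) k := by
    intro y hy
    obtain ⟨Y, hY, rfl⟩ := Finset.mem_image.1 hy
    exact Finset.mem_filter.2 ⟨(hx Y hY).2, rfl⟩
  have hcard := Finset.card_le_card hsub
  rw [Finset.card_image_of_injOn] at hcard
  · obtain ⟨Y, hY⟩ := Finset.card_pos.1 (Nat.zero_lt_of_lt hs)
    exact absurd (hcard.trans (hx Y hY).1) (not_le.2 hs)
  · intro Y hY Z hZ h
    exact hk₀ k (not_lt.1 hk) hY hZ (Prod.ext_iff.1 h).2

/-- For large `k` the traces of the `e i` with `i ∈ t` are distinct, and the relation consisting of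
exactly the required pairs lies in the cell. -/
theorem independentOn_linkedFamily (he : Function.Injective e) :
    IndependentOn (linkedFamily e) univ cofinite := by
  classical
  intro t _ s
  rw [frequently_cofinite_iff_infinite]
  obtain ⟨k₀, hk₀⟩ := eventually_atTop.1 (eventually_injOn_finTrace (t.image e))
  let R : ∀ k, Finset (Finset (Fin k) × Finset (Fin k)) := fun k =>
    (t.sigma s).image fun p => (finTrace (e p.1) k, finTrace p.2 k)
  have hinf : ((fun k => (⟨k, R k⟩ : FiniteRelation)) '' Ici k₀).Infinite :=
    (Ici_infinite k₀).image fun a _ b _ h => (Sigma.ext_iff.1 h).1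
  refine hinf.mono ?_
  rintro _ ⟨k, hk, rfl⟩ i hi Y hY
  constructor
  · refine (Finset.card_le_card (t := (s i).image
      fun Y => (finTrace (e i) k, finTrace Y k)) ?_).trans Finset.card_image_le
    intro y hy
    obtain ⟨hy, hyi⟩ := Finset.mem_filter.1 hy
    obtain ⟨⟨i', Z⟩, hp, rfl⟩ := Finset.mem_image.1 hy
    obtain ⟨hi', hZ⟩ := Finset.mem_sigma.1 hp
    have : i' = i := he (hk₀ k hk (by simpa using ⟨i', hi', rfl⟩)
      (by simpa using ⟨i, hi, rfl⟩) hyi)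
    subst this
    exact Finset.mem_image_of_mem _ hZ
  · exact Finset.mem_image.2 ⟨⟨i, Y⟩, Finset.mem_sigma.2 ⟨hi, hY⟩, rfl⟩

end LinkedFamily

/-! ### Many Rudin–Keisler inequivalent weak P-points -/

theorem exists_injective_isWeakPPoint :
    ∃ W : Set (Set ℕ) → Ultrafilter FiniteRelation,
      Function.Injective W ∧ ∀ f, IsWeakPPoint (W f) := by
  classical
  -- The left half of the indices codes `f`; the right half, of size `𝔠`, is kept for the weak
  -- P-point construction.
  obtain ⟨e⟩ : Nonempty (Set ℕ ⊕ Set ℕ ↪ Set ℕ) := by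
    rw [← Cardinal.le_def]
    simp
  set A := linkedFamily e
  let y : Set (Set ℕ) → Set ℕ ⊕ Set ℕ → Finset (Set ℕ) := fun f =>
    Sum.elim (fun i => {if i ∈ f then univ else ∅}) fun _ => ∅
  have hind : IndependentOn A univ cofinite := independentOn_linkedFamily e e.injective
  have hfin : ∀ i n (s : Finset (Set ℕ)), n < s.card → {x | ∀ Y ∈ s, x ∈ A i Y n}.Finite :=
    fun i n s hs => finite_linkedFamily e i n s hs
  have key : ∀ f : Set (Set ℕ), ∃ p : Ultrafilter FiniteRelation,
      (∀ i, A (Sum.inl i) (if i ∈ f then univ else ∅) 1 ∈ p) ∧ IsWeakPPoint p := by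
    intro f
    let F : Filter FiniteRelation := ⨅ t : Finset (Set ℕ),
      cofinite ⊓ 𝓟 (linkedCell A (t.map Function.Embedding.inl) (y f))
    have hF : IndependentOn A (range Sum.inr) F := by
      refine IndependentOn.iInf (Antitone.directed_ge ?_) fun t => ?_
      · intro a b hab
        refine inf_le_inf_left _ (principal_mono.2 fun x hx i hi => hx i ?_)
        exact Finset.map_subset_map.2 hab hi
      · refine (hind.inf_linkedCell (subset_univ _) (y f)).mono ?_
        rintro _ ⟨i, rfl⟩
        simp
    have hFc : F ≤ cofinite :=
      (iInf_le (fun t : Finset (Set ℕ) =>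
        cofinite ⊓ 𝓟 (linkedCell A (t.map Function.Embedding.inl) (y f))) ∅).trans inf_le_left
    have : Uncountable (Set ℕ) := by
      rw [← Cardinal.aleph0_lt_mk_iff]
      simpa using Cardinal.cantor ℵ₀
    obtain ⟨p, hpF, hp⟩ := hF.exists_isWeakPPoint (fun i Y => monotone_linkedFamily e i Y) hfin
      (by rw [Cardinal.mk_range_eq _ Sum.inr_injective]; simp) hFc
    refine ⟨p, fun i => hpF ?_, hp⟩
    refine mem_iInf_of_mem {i} (mem_inf_of_right ?_)
    intro x hx
    simpa [y] using hx (Sum.inl i) (by simp)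
  choose W hW hWP using key
  refine ⟨W, ?_, hWP⟩
  have haux : ∀ (f g : Set (Set ℕ)) (i : Set ℕ), W f = W g → i ∈ f → i ∈ g := by
    intro f g i hfg hif
    by_contra hig
    have h1 := hW f i
    have h2 := hW g i
    rw [← hfg, if_neg hig] at h2
    rw [if_pos hif] at h1
    -- At level `1` the sets for `univ` and `∅` have finite intersection, so a free ultrafilter
    -- cannot contain both.
    have h3 := (hWP f).1 (hfin (Sum.inl i) 1 {univ, ∅} (by
      rw [Finset.card_pair (by simp)]; simp)).compl_mem_cofinite
    refine Ultrafilter.compl_notMem_iff.2 ?_ h3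
    filter_upwards [h1, h2] with x hx1 hx2
    simp [hx1, hx2]
  intro f g hfg
  exact Set.ext fun i => ⟨haux f g i hfg, haux g f i hfg.symm⟩

/-- There are as many weak P-points as one likes, up to `2 ^ 𝔠`, no two of which are
Rudin–Keisler equivalent. -/
theorem exists_isWeakPPoint_family (T : Type) (hT : #T ≤ 2 ^ 𝔠) :
    ∃ W : T → Ultrafilter FiniteRelation, (∀ t, IsWeakPPoint (W t)) ∧
      ∀ t t' h k, W t = (W t').map h → W t' = (W t).map k → t = t' := by
  obtain ⟨W, hW, hWP⟩ := exists_injective_isWeakPPoint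
  let R : Setoid (Set (Set ℕ)) :=
    { r := fun f g => (∃ h, W f = (W g).map h) ∧ ∃ h, W g = (W f).map h
      iseqv :=
        { refl := fun f => ⟨⟨id, by simp⟩, ⟨id, by simp⟩⟩
          symm := fun h => ⟨h.2, h.1⟩
          trans := by
            rintro f g h ⟨⟨a, ha⟩, b, hb⟩ ⟨⟨c, hc⟩, d, hd⟩
            exact ⟨⟨a ∘ c, by rw [ha, hc, Ultrafilter.map_map]⟩,
              ⟨d ∘ b, by rw [hd, hb, Ultrafilter.map_map]⟩⟩ } }
  -- There are only `𝔠` self-maps of a countable set, so an equivalence class has at most `𝔠`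
  -- members.
  have hfib : ∀ q : Quotient R, #((Quotient.mk R) ⁻¹' {q}) ≤ 𝔠 := by
    intro q
    induction q using Quotient.inductionOn with
    | h g =>
    have hex : ∀ f : (Quotient.mk R) ⁻¹' {⟦g⟧}, ∃ h, W f = (W g).map h := fun f =>
      (Quotient.exact f.2).1
    choose h hh using hex
    have hinj : Function.Injective h := by
      intro f f' hff
      exact Subtype.ext (hW (by rw [hh f, hh f', hff]))
    refine (Cardinal.mk_le_of_injective hinj).trans ?_
    rw [← Cardinal.power_def]
    refine (Cardinal.power_le_power_right (c := #FiniteRelation)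
      (Cardinal.mk_le_aleph0.trans Cardinal.aleph0_le_continuum)).trans ?_
    refine (Cardinal.power_le_power_left Cardinal.continuum_ne_zero
      Cardinal.mk_le_aleph0).trans ?_
    simp
  have hle := Cardinal.mk_le_mk_mul_of_mk_preimage_le (Quotient.mk R) hfib
  have hQ : 2 ^ 𝔠 ≤ #(Quotient R) := by
    by_contra! hlt
    have hc : 𝔠 < 2 ^ 𝔠 := Cardinal.cantor 𝔠
    have := Cardinal.mul_lt_of_lt (Cardinal.aleph0_le_continuum.trans hc.le) hlt hc
    refine absurd hle (not_le.2 (this.trans_le ?_))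
    simp
  obtain ⟨φ⟩ := (Cardinal.le_def _ _).1 (hT.trans hQ)
  refine ⟨fun t => W (φ t).out, fun t => hWP _, fun t t' h k h1 h2 => φ.injective ?_⟩
  rw [← (φ t).out_eq, ← (φ t').out_eq]
  exact Quotient.sound ⟨⟨h, h1⟩, ⟨k, h2⟩⟩

/-! ### Disjoint members for countably many weak P-points -/

section Disjoint

variable {S X κ : Type}

theorem Ultrafilter.exists_eq_map_of_map_eq [Nonempty S] {a b : S → X}
    (hb : Function.Injective b) {p q : Ultrafilter S} (h : p.map a = q.map b) :
    ∃ f : S → S, q = p.map f := by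
  refine ⟨Function.invFun b ∘ a, ?_⟩
  rw [← Ultrafilter.map_map, h, Ultrafilter.map_map,
    Function.LeftInverse.comp_eq_id (Function.leftInverse_invFun hb), Ultrafilter.map_id]

/-- Countably many weak P-points, no two of which are Rudin–Keisler equivalent, have disjoint
elements, also after transport along injections. -/
theorem exists_pairwise_disjoint_mem_map [Nonempty S] [Countable κ] {W : κ → Ultrafilter S}
    (hW : ∀ i, IsWeakPPoint (W i))
    (hne : ∀ i j h k, W i = (W j).map h → W j = (W i).map k → i = j)
    {a : κ → S → X} (ha : ∀ i, Function.Injective (a i)) :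
    ∃ D : κ → Set X, (∀ i, D i ∈ (W i).map (a i)) ∧ Pairwise fun i j => Disjoint (D i) (D j) := by
  have hE : ∀ i, ∃ E ∈ (W i).map (a i), ∀ j, j ≠ i → E ∉ (W j).map (a j) := by
    intro i
    -- These are the other image ultrafilters pulled back along `a i`; inequivalence ensures that `W
    -- i` is not among them.
    let Q : Set (Ultrafilter S) := ⋃ j ∈ {j | j ≠ i}, {q | q.map (a i) = (W j).map (a j)}
    have hQ : Q.Countable := by
      refine (to_countable _).biUnion fun j _ => Set.Subsingleton.countable ?_
      intro q hq q' hq'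
      have : q.map (a i) = q'.map (a i) := hq.trans hq'.symm
      rw [← Ultrafilter.coe_inj] at this ⊢
      exact map_injective (ha i) this
    obtain ⟨E, hE, hEQ⟩ := (hW i).2 Q hQ (by
      intro q hq
      simp only [Q, mem_iUnion] at hq
      obtain ⟨j, hj, hq⟩ := hq
      have hq : q.map (a i) = (W j).map (a j) := hq
      constructor
      · rintro rfl
        obtain ⟨h, hh⟩ := Ultrafilter.exists_eq_map_of_map_eq (ha i) hq.symm
        obtain ⟨k, hk⟩ := Ultrafilter.exists_eq_map_of_map_eq (ha j) hq
        exact hj (hne i j h k hh hk).symm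
      · rw [← (ha i).comap_cofinite_eq, ← map_le_iff_le_comap]
        have : (q : Filter S).map (a i) = (W j : Filter S).map (a j) := by
          rw [← Ultrafilter.coe_map, hq, Ultrafilter.coe_map]
        rw [this]
        exact (map_mono (hW j).1).trans (ha j).tendsto_cofinite)
    refine ⟨a i '' E, image_mem_map hE, fun j hj hEj => ?_⟩
    have hr : range (a i) ∈ (W j).map (a j) := mem_of_superset hEj (image_subset_range _ _)
    let q := ((W j).map (a j)).comap (ha i) hr
    have hq : q.map (a i) = (W j).map (a j) := by
      rw [← Ultrafilter.coe_inj, Ultrafilter.coe_map, Ultrafilter.coe_comap]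
      exact map_comap_of_mem hr
    refine hEQ q (mem_biUnion (show j ∈ {j | j ≠ i} from hj) hq) ?_
    rw [← hq, Ultrafilter.mem_map, (ha i).preimage_image] at hEj
    exact hEj
  choose E hE hEj using hE
  obtain ⟨c⟩ := nonempty_encodable κ
  refine ⟨fun i => E i \ ⋃ j ∈ {j | Encodable.encode j < Encodable.encode i}, E j,
    fun i => ?_, ?_⟩
  · refine inter_mem (hE i) ?_
    have hfin : {j : κ | Encodable.encode j < Encodable.encode i}.Finite :=
      (finite_Iio (Encodable.encode i)).preimage Encodable.encode_injective.injOn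
    have : (⋃ j ∈ {j | Encodable.encode j < Encodable.encode i}, E j)ᶜ =
        ⋂ j ∈ {j | Encodable.encode j < Encodable.encode i}, (E j)ᶜ := by simp
    change (⋃ j ∈ {j | Encodable.encode j < Encodable.encode i}, E j)ᶜ ∈ _
    rw [this]
    refine (biInter_mem hfin).2 fun j hj => Ultrafilter.compl_mem_iff_notMem.2 (hEj j i ?_)
    rintro rfl
    exact lt_irrefl (Encodable.encode i) hj
  · intro i j hij
    rw [Set.disjoint_left]
    rintro x ⟨hxi, hxi'⟩ ⟨hxj, hxj'⟩
    rcases lt_trichotomy (Encodable.encode i) (Encodable.encode j) with h | h | h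
    · exact hxj' (mem_biUnion (show i ∈ {i | _} from h) hxi)
    · exact hij (Encodable.encode_injective h)
    · exact hxi' (mem_biUnion (show j ∈ {j | _} from h) hxj)

end Disjoint

/-! ### Hausdorff topologies from ultrafilters -/

section BranchTopology

variable {X S : Type}

/-- The topology for which a set is open when it belongs to the ultrafilters `u x b` for all points
`x` of `N` that it contains. -/
abbrev branchTopology (N : Set X) (u : X → Bool → Ultrafilter X) : TopologicalSpace X where
  IsOpen U := ∀ x ∈ U, x ∈ N → ∀ b, U ∈ u x b
  isOpen_univ _ _ _ _ := univ_mem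
  isOpen_inter U V hU hV x hx hN b := inter_mem (hU x hx.1 hN b) (hV x hx.2 hN b)
  isOpen_sUnion 𝒰 h𝒰 x hx hN b := by
    obtain ⟨U, hU, hxU⟩ := hx
    exact mem_of_superset (h𝒰 U hU x hxU hN b) (subset_sUnion_of_mem hU)

theorem exists_countable_superset_closed [Countable S] (a : X → Bool → S → X) {C₀ : Set X}
    (hC₀ : C₀.Countable) :
    ∃ C : Set X, C.Countable ∧ C₀ ⊆ C ∧ ∀ z ∈ C, ∀ b s, a z b s ∈ C := by
  let f : Set X → Set X := fun C => ⋃ z ∈ C, ⋃ b, range (a z b)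
  refine ⟨⋃ n, f^[n] C₀, countable_iUnion fun n => ?_, subset_iUnion (fun n => f^[n] C₀) 0, ?_⟩
  · induction n with
    | zero => exact hC₀
    | succ n ih =>
      rw [Function.iterate_succ_apply']
      exact ih.biUnion fun z _ => countable_iUnion fun b => countable_range _
  · intro z hz b s
    obtain ⟨n, hn⟩ := mem_iUnion.1 hz
    refine mem_iUnion.2 ⟨n + 1, ?_⟩
    rw [Function.iterate_succ_apply']
    exact mem_biUnion hn (mem_iUnion.2 ⟨b, mem_range_self s⟩)

/-- Inside a countable set closed under the sequences, disjoint members of the ultrafilters give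
every point at most one parent. Descendant sets are open. A common descendant of `x` and `y` would
make one descend from the other, which is excluded because neither is allowed as a child. -/
theorem t2Space_branchTopology [Nonempty S] [Countable S] (N : Set X) {a : X → Bool → S → X}
    (ha : ∀ x b, Function.Injective (a x b)) {W : X × Bool → Ultrafilter S}
    (hW : ∀ i, IsWeakPPoint (W i))
    (hne : ∀ i j h k, W i = (W j).map h → W j = (W i).map k → i = j) :
    @T2Space X (branchTopology N fun x b => (W (x, b)).map (a x b)) := by
  let _ := branchTopology N fun x b => (W (x, b)).map (a x b)
  refine ⟨fun x y hxy => ?_⟩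
  obtain ⟨C, hC, hxyC, hCa⟩ := exists_countable_superset_closed a
    (C₀ := {x, y}) (toFinite _).countable
  have := hC.to_subtype
  obtain ⟨D, hD, hdisj⟩ := exists_pairwise_disjoint_mem_map
    (κ := C × Bool) (W := fun i => W (i.1, i.2)) (a := fun i => a i.1 i.2)
    (fun i => hW _) (fun i j h k h1 h2 => by
      have := hne _ _ h k h1 h2
      simp only [Prod.mk.injEq] at this
      exact Prod.ext (Subtype.ext this.1) this.2) (fun i => ha _ _)
  let R : X → X → Prop := fun z w =>
    ∃ (hz : z ∈ C) (b : Bool), w ∈ D (⟨z, hz⟩, b) ∧ w ∈ C ∧ w ≠ x ∧ w ≠ y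
  have hopen : ∀ r ∈ C, IsOpen {w | Relation.ReflTransGen R r w} := by
    intro r hr z hz _ b
    have hzC : z ∈ C := by
      rcases Relation.ReflTransGen.cases_tail hz with h | ⟨_, _, h⟩
      · exact h ▸ hr
      · exact h.2.choose_spec.2.1
    have hcof : ((W (z, b)).map (a z b) : Filter X) ≤ cofinite :=
      (map_mono (hW _).1).trans (ha z b).tendsto_cofinite
    have h1 : {x}ᶜ ∈ (W (z, b)).map (a z b) := hcof (finite_singleton x).compl_mem_cofinite
    have h2 : {y}ᶜ ∈ (W (z, b)).map (a z b) := hcof (finite_singleton y).compl_mem_cofinite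
    have h3 : C ∈ (W (z, b)).map (a z b) :=
      Ultrafilter.mem_map.2 (univ_mem' fun s => hCa z hzC b s)
    filter_upwards [h1, h2, h3, hD (⟨z, hzC⟩, b)] with w hw1 hw2 hw3 hw4
    exact Relation.ReflTransGen.tail hz ⟨hzC, b, hw4, hw3, hw1, hw2⟩
  have huniq : Relator.RightUnique (Function.swap R) := by
    rintro w z z' ⟨hz, b, hw, _⟩ ⟨hz', b', hw', _⟩
    by_contra hzz
    refine Set.disjoint_left.1 (hdisj (i := (⟨z, hz⟩, b)) (j := (⟨z', hz'⟩, b')) ?_) hw hw'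
    intro h
    exact hzz (congrArg Subtype.val (Prod.ext_iff.1 h).1)
  refine ⟨_, _, hopen x (hxyC (by simp)), hopen y (hxyC (by simp)),
    Relation.ReflTransGen.refl, Relation.ReflTransGen.refl, Set.disjoint_left.2 ?_⟩
  intro w hwx hwy
  rcases Relation.ReflTransGen.total_of_right_unique huniq
    (Relation.reflTransGen_swap.2 hwx) (Relation.reflTransGen_swap.2 hwy) with h | h
  · rcases Relation.ReflTransGen.cases_tail (Relation.reflTransGen_swap.1 h) with h | ⟨_, _, h⟩
    · exact hxy h
    · exact h.2.choose_spec.2.2.1 rfl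
  · rcases Relation.ReflTransGen.cases_tail (Relation.reflTransGen_swap.1 h) with h | ⟨_, _, h⟩
    · exact hxy h.symm
    · exact h.2.choose_spec.2.2.2 rfl

end BranchTopology

/-! ### The space of labelled trees -/

section Tree

/-- Well-founded trees with leaves in `S`, whose inner nodes have a label in `T` and two sequences
of subtrees indexed by `S`. -/
inductive LabelledTree (T S : Type) : Type
  | leaf : S → LabelledTree T S
  | node : T → (Bool → S → LabelledTree T S) → LabelledTree T S

namespace LabelledTree

variable {T S : Type}

/-- The arities of the nodes of a labelled tree. -/
abbrev Arity (T S : Type) : S ⊕ T → Type := Sum.elim (fun _ => Empty) fun _ => Bool × S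

/-- The embedding of labelled trees into a W-type. -/
def toWType : LabelledTree T S → WType (Arity T S)
  | leaf s => WType.mk (Sum.inl s) (fun e => Empty.elim e)
  | node t f => WType.mk (Sum.inr t) fun p => toWType (f p.1 p.2)

theorem toWType_injective : Function.Injective (toWType : LabelledTree T S → _) := by
  intro x
  induction x with
  | leaf s =>
    rintro (s' | ⟨t', f'⟩) h
    · simp only [toWType, WType.mk.injEq, Sum.inl.injEq] at h
      rw [h.1]
    · simp only [toWType, WType.mk.injEq, reduceCtorEq, false_and] at h
  | node t f ih =>
    rintro (s' | ⟨t', f'⟩) h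
    · simp only [toWType, WType.mk.injEq, reduceCtorEq, false_and] at h
    · simp only [toWType, WType.mk.injEq, Sum.inr.injEq] at h
      obtain ⟨rfl, h⟩ := h
      have h := eq_of_heq h
      congr 1
      funext b s
      exact ih b s (congrFun h (b, s))

/-- Nodes have countable arity, and `2 ^ 𝔠` absorbs both the number of labels and powers with
exponent at most `𝔠`. -/
theorem mk_le [Countable S] : #(LabelledTree (Set (Set ℕ)) S) ≤ 2 ^ 𝔠 := by
  refine (Cardinal.mk_le_of_injective toWType_injective).trans
    (WType.cardinalMk_le_of_le' ?_)
  have h2c : ℵ₀ ≤ (2 : Cardinal.{0}) ^ 𝔠 :=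
    Cardinal.aleph0_le_continuum.trans (Cardinal.cantor 𝔠).le
  have hT : #(S ⊕ Set (Set ℕ)) ≤ 2 ^ 𝔠 := by
    simp only [Cardinal.mk_sum, Cardinal.lift_id, Cardinal.mk_set, Cardinal.mk_nat,
      Cardinal.two_power_aleph0]
    exact Cardinal.add_le_of_le h2c (Cardinal.mk_le_aleph0.trans h2c) le_rfl
  refine (Cardinal.sum_le_sum _ (fun _ => 2 ^ 𝔠) fun i => ?_).trans ?_
  · have hi : #(Arity (Set (Set ℕ)) S i) ≤ 𝔠 := by
      rcases i with i | i
      · exact (Cardinal.mk_le_aleph0 (α := Empty)).trans Cardinal.aleph0_le_continuum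
      · exact (Cardinal.mk_le_aleph0 (α := Bool × S)).trans Cardinal.aleph0_le_continuum
    rw [← Cardinal.power_mul, Cardinal.lift_id]
    exact Cardinal.power_le_power_left two_ne_zero
      (Cardinal.mul_le_of_le Cardinal.aleph0_le_continuum le_rfl hi)
  · rw [Cardinal.sum_const']
    exact Cardinal.mul_le_of_le h2c hT le_rfl

/-- The sequence on the side `b` of a node; the sequence of the leaves if that one is not
injective. -/
noncomputable def side (x : LabelledTree T S) (b : Bool) : S → LabelledTree T S :=
  open Classical in
  match x with
  | leaf _ => leaf
  -- The default keeps every sequence injective, so that free ultrafilters have free images and can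
  -- be pulled back.
  | node _ f => if Function.Injective (f b) then f b else leaf

theorem leaf_injective : Function.Injective (leaf : S → LabelledTree T S) :=
  fun _ _ h => leaf.inj h

theorem side_injective (x : LabelledTree T S) (b : Bool) : Function.Injective (side x b) := by
  rcases x with s | ⟨t, f⟩
  · exact leaf_injective
  · simp only [side]
    split_ifs with h
    · exact h
    · exact leaf_injective

variable (W : LabelledTree T S × Bool → Ultrafilter S)

/-- The topology on labelled trees in which leaves are isolated and nodes are limits of their
sequences along the given ultrafilters. -/
noncomputable abbrev topology : TopologicalSpace (LabelledTree T S) :=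
  branchTopology (range leaf)ᶜ fun x b => (W (x, b)).map (side x b)

theorem exists_leaf_mem {U : Set (LabelledTree T S)} (hU : @IsOpen _ (topology W) U)
    (x : LabelledTree T S) (hx : x ∈ U) : ∃ s, leaf s ∈ U := by
  induction x with
  | leaf s => exact ⟨s, hx⟩
  | node t f ih =>
    have h := hU _ hx (by simp) true
    obtain ⟨s, hs⟩ := Ultrafilter.nonempty_of_mem (Ultrafilter.mem_map.1 h)
    simp only [side, mem_preimage] at hs
    split_ifs at hs
    · exact ih true s hs
    · exact ⟨s, hs⟩

theorem node_mem_closure {t : T} {f : Bool → S → LabelledTree T S} {b : Bool}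
    (hf : Function.Injective (f b)) {E : Set (LabelledTree T S)}
    (hE : @IsClosed _ (topology W) E) (hfE : ∀ s, f b s ∈ E) : node t f ∈ E := by
  let _ := topology W
  by_contra hx
  have h := hE.isOpen_compl _ hx (by simp) b
  obtain ⟨s, hs⟩ := Ultrafilter.nonempty_of_mem (Ultrafilter.mem_map.1 h)
  simp only [side, if_pos hf, mem_preimage] at hs
  exact hs (hfE s)

theorem isStronglyAntiUrysohn [Countable S] [Nontrivial T]
    (hW : ∀ i, (W i : Filter S) ≤ cofinite) :
    @IsStronglyAntiUrysohn (LabelledTree T S) (topology W) := by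
  have hiso : ∀ t f, ¬ @IsOpen _ (topology W) {(node t f : LabelledTree T S)} := by
    intro t f h
    have h := h _ rfl (by simp) true
    have hc : ((W (node t f, true)).map (side (node t f) true) : Filter (LabelledTree T S)) ≤
      cofinite := (map_mono (hW _)).trans (side_injective _ _).tendsto_cofinite
    exact Ultrafilter.compl_notMem_iff.2 h (hc (finite_singleton _).compl_mem_cofinite)
  obtain ⟨t, t', htt⟩ := exists_pair_ne T
  let _ := topology W
  refine ⟨⟨node t fun _ => leaf, node t' fun _ => leaf, fun h => htt (node.inj h).1,
    hiso _ _, hiso _ _⟩, fun E F hE hF hEi hFi => ?_⟩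
  have hemb : ∀ G : Set (LabelledTree T S), G.Infinite →
      ∃ g : S → LabelledTree T S, Function.Injective g ∧ ∀ s, g s ∈ G := by
    intro G hG
    have := hG.to_subtype
    obtain ⟨g⟩ := (Cardinal.le_def S G).1 (Cardinal.mk_le_aleph0.trans (Cardinal.aleph0_le_mk G))
    exact ⟨fun s => g s, Subtype.val_injective.comp g.injective, fun s => (g s).2⟩
  obtain ⟨g, hg, hgE⟩ := hemb E hEi
  obtain ⟨h, hh, hhF⟩ := hemb F hFi
  -- The common point is the node whose two sequences run through `E` and `F`.
  exact ⟨node t fun b => if b then g else h,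
    node_mem_closure W (b := true) (by simpa using hg) hE (by simpa using hgE),
    node_mem_closure W (b := false) (by simpa using hh) hF (by simpa using hhF)⟩

end LabelledTree

theorem exists_separable_stronglyAntiUrysohn :
    ∃ (X : Type) (_ : TopologicalSpace X),
      T2Space X ∧ TopologicalSpace.SeparableSpace X ∧ IsStronglyAntiUrysohn X ∧
        #X = 2 ^ 𝔠 := by
  have hle : #(LabelledTree (Set (Set ℕ)) FiniteRelation) ≤ 2 ^ 𝔠 := LabelledTree.mk_le
  obtain ⟨W, hW, hne⟩ := exists_isWeakPPoint_family
    (LabelledTree (Set (Set ℕ)) FiniteRelation × Bool) (by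
      rw [Cardinal.mk_prod, Cardinal.lift_id, Cardinal.lift_id]
      exact Cardinal.mul_le_of_le (Cardinal.aleph0_le_continuum.trans (Cardinal.cantor 𝔠).le) hle
        (Cardinal.mk_le_aleph0.trans
          (Cardinal.aleph0_le_continuum.trans (Cardinal.cantor 𝔠).le)))
  let _ := LabelledTree.topology W
  refine ⟨LabelledTree (Set (Set ℕ)) FiniteRelation, inferInstance,
    t2Space_branchTopology _ LabelledTree.side_injective hW hne,
    ⟨range LabelledTree.leaf, countable_range _, ?_⟩,
    LabelledTree.isStronglyAntiUrysohn W fun i => (hW i).1, hle.antisymm ?_⟩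
  · rw [dense_iff_inter_open]
    rintro U hU ⟨x, hx⟩
    obtain ⟨s, hs⟩ := LabelledTree.exists_leaf_mem W hU x hx
    exact ⟨_, hs, s, rfl⟩
  · have := Cardinal.mk_le_of_injective (f := fun t : Set (Set ℕ) =>
      LabelledTree.node t fun _ => (LabelledTree.leaf : FiniteRelation → _))
      fun t t' h => (LabelledTree.node.inj h).1
    simpa using this

/-! ### The regular open topology -/

section RegularOpenSpace

variable {X : Type*} [TopologicalSpace X]

theorem le_regularOpenTopology : ‹TopologicalSpace X› ≤ regularOpenTopology X :=
  le_generateFrom fun U hU => by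
    have hU : interior (closure U) = U := hU
    exact hU ▸ isOpen_interior

theorem isOpen_of_isOpen_regularOpenSpace {U : Set X}
    (hU : IsOpen (X := RegularOpenSpace X) U) : IsOpen U :=
  le_regularOpenTopology U hU

theorem isClosed_of_isClosed_regularOpenSpace {E : Set X}
    (hE : IsClosed (X := RegularOpenSpace X) E) : IsClosed E :=
  isOpen_compl_iff.1 (isOpen_of_isOpen_regularOpenSpace hE.isOpen_compl)

theorem isOpen_regularOpenSpace_interior_closure (U : Set X) :
    IsOpen (X := RegularOpenSpace X) (interior (closure U) : Set X) :=
  TopologicalSpace.isOpen_generateFrom_of_mem (α := X)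
    (show interior (closure (interior (closure U))) = _ from interior_closure_idem)

instance RegularOpenSpace.t2Space [T2Space X] : T2Space (RegularOpenSpace X) := by
  refine ⟨fun x y hxy => ?_⟩
  obtain ⟨U, V, hU, hV, hx, hy, hUV⟩ := t2_separation (X := X) hxy
  refine ⟨_, _, isOpen_regularOpenSpace_interior_closure U,
    isOpen_regularOpenSpace_interior_closure V, ?_, ?_, ?_⟩
  · exact interior_maximal subset_closure hU hx
  · exact interior_maximal subset_closure hV hy
  · have h1 : Disjoint (closure U) V := hUV.closure_left hV
    have h2 : Disjoint (interior (closure U)) (closure V) :=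
      (h1.mono_left interior_subset).closure_right isOpen_interior
    exact h2.mono_right interior_subset

theorem IsStronglyAntiUrysohn.regularOpenSpace (h : IsStronglyAntiUrysohn X) :
    IsStronglyAntiUrysohn (RegularOpenSpace X) := by
  obtain ⟨x, y, hxy, hx, hy⟩ := h.two_nonisolated
  exact ⟨⟨x, y, hxy, fun h' => hx (isOpen_of_isOpen_regularOpenSpace h'),
    fun h' => hy (isOpen_of_isOpen_regularOpenSpace h')⟩, fun E F hE hF =>
    h.inter_nonempty E F (isClosed_of_isClosed_regularOpenSpace hE)
      (isClosed_of_isClosed_regularOpenSpace hF)⟩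

theorem isTopologicalBasis_regularOpen :
    @TopologicalSpace.IsTopologicalBasis X (regularOpenTopology X)
      {U : Set X | interior (closure U) = U} := by
  refine @TopologicalSpace.IsTopologicalBasis.mk X (regularOpenTopology X) _ ?_ ?_ rfl
  · intro U hU V hV x hx
    refine ⟨U ∩ V, ?_, hx, subset_rfl⟩
    have hU : interior (closure U) = U := hU
    have hV : interior (closure V) = V := hV
    have ho : IsOpen (U ∩ V) :=
      (hU ▸ isOpen_interior : IsOpen U).inter (hV ▸ isOpen_interior)
    refine Subset.antisymm (subset_inter ?_ ?_) (interior_maximal subset_closure ho)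
    · exact (interior_mono (closure_mono inter_subset_left)).trans hU.subset
    · exact (interior_mono (closure_mono inter_subset_right)).trans hV.subset
  · exact eq_univ_of_univ_subset (subset_sUnion_of_mem (by simp))

/-- A regular open `U` is recovered from `U ∩ D`, for `D` countable and dense, as the interior of
the closure. -/
theorem spaceWeight_regularOpenSpace_le [TopologicalSpace.SeparableSpace X] :
    spaceWeight (RegularOpenSpace X) ≤ 𝔠 := by
  obtain ⟨D, hD, hDd⟩ := TopologicalSpace.exists_countable_dense X
  set R : Set (Set X) := {U : Set X | interior (closure U) = U}
  have hR : #R ≤ 𝔠 := by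
    have hsurj : R ⊆ range fun B : Set D => interior (closure (Subtype.val '' B)) := by
      intro U hU
      have hU : interior (closure U) = U := hU
      have hUo : IsOpen U := hU ▸ isOpen_interior
      refine ⟨Subtype.val ⁻¹' U, ?_⟩
      have : closure (U ∩ D) = closure U :=
        (closure_mono inter_subset_left).antisymm
          (closure_minimal (hDd.open_subset_closure_inter hUo) isClosed_closure)
      simp only [Subtype.image_preimage_coe]
      rw [inter_comm, this, hU]
    refine (Cardinal.mk_le_mk_of_subset hsurj).trans (Cardinal.mk_range_le.trans ?_)
    rw [Cardinal.mk_set, ← Cardinal.two_power_aleph0]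
    exact Cardinal.power_le_power_left two_ne_zero hD.le_aleph0
  have hb : TopologicalSpace.IsTopologicalBasis (α := RegularOpenSpace X) R :=
    isTopologicalBasis_regularOpen (X := X)
  exact (csInf_le' ⟨R, hb, rfl⟩ : spaceWeight (RegularOpenSpace X) ≤ #R).trans hR

end RegularOpenSpace

/-! ### Free sets in strongly anti-Urysohn spaces -/

section Free

/-- The number of predecessors is strictly increasing on `P`, hence injective there. -/
theorem countable_of_finite_predecessors {α : Type*} (r : α → α → Prop) [IsWellOrder α r]
    (P : Set α) (hP : ∀ b ∈ P, {a | r a b}.Finite) : P.Countable := by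
  refine (mapsTo_univ (fun b => {a | r a b}.ncard) P).countable_of_injOn ?_ (to_countable _)
  have hlt : ∀ b c, c ∈ P → r b c → {a | r a b}.ncard < {a | r a c}.ncard := by
    intro b c hc hbc
    refine ncard_lt_ncard ⟨fun a ha => _root_.trans (r := r) ha hbc, fun h => ?_⟩ (hP c hc)
    exact irrefl_of r b (h hbc)
  intro b hb c hc h
  rcases trichotomous_of r b c with hbc | hbc | hbc
  · exact absurd h (hlt b c hc hbc).ne
  · exact hbc
  · exact absurd h (hlt c b hb hbc).ne'

variable {X : Type*} [TopologicalSpace X]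

theorem IsStronglyAntiUrysohn.countable_of_isFreeSet (h : IsStronglyAntiUrysohn X) {S : Set X}
    (hS : IsFreeSet S) : S.Countable := by
  obtain ⟨r, hr, hfree⟩ := hS
  have hfin : ∀ b : S, {a : S | r a b}.Finite ∨ {a : S | ¬ r a b}.Finite := by
    intro b
    by_contra! hc
    have := h.inter_nonempty _ _ isClosed_closure isClosed_closure
      ((Set.Infinite.image Subtype.val_injective.injOn hc.1).mono subset_closure)
      ((Set.Infinite.image Subtype.val_injective.injOn hc.2).mono subset_closure)
    exact this.ne_empty (hfree b)
  rw [← countable_coe_iff, ← countable_univ_iff]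
  by_cases hb : ∃ b : S, ¬ {a : S | r a b}.Finite
  · have hwf : WellFounded r := hr.toIsWellFounded.wf
    -- Everything before this least `b` has finitely many predecessors, while the part from `b` on
    -- must be finite.
    set b := hwf.min {b : S | ¬ {a : S | r a b}.Finite} hb
    have hbm : ¬ {a : S | r a b}.Finite := hwf.min_mem _ hb
    have h1 : {a : S | r a b}.Countable := countable_of_finite_predecessors r _ fun c hc =>
      not_not.1 fun hn => hwf.not_lt_min _ hn hc
    have h2 := ((hfin b).resolve_left hbm).countable
    exact (h1.union h2).mono fun a _ => em (r a b)
  · push Not at hb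
    exact countable_of_finite_predecessors r _ fun c _ => hb c

theorem Set.Finite.isFreeSet [T1Space X] {S : Set X} (hS : S.Finite) : IsFreeSet S := by
  refine ⟨WellOrderingRel, inferInstance, fun b => ?_⟩
  have := hS.to_subtype
  rw [((toFinite _).image _).isClosed.closure_eq, ((toFinite _).image _).isClosed.closure_eq,
    ← image_inter Subtype.val_injective]
  convert image_empty _
  ext a
  simp

theorem IsStronglyAntiUrysohn.freeSetNumber_eq [T1Space X] [Infinite X]
    (h : IsStronglyAntiUrysohn X) : freeSetNumber X = ℵ₀ := by
  have hub : ∀ κ ∈ {κ | ∃ S : Set X, IsFreeSet S ∧ κ = #S}, κ ≤ ℵ₀ := by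
    rintro _ ⟨S, hS, rfl⟩
    exact (h.countable_of_isFreeSet hS).le_aleph0
  refine (csSup_le' hub).antisymm (Cardinal.aleph0_le.2 fun n => ?_)
  obtain ⟨s, hs⟩ := Infinite.exists_subset_card_eq X n
  exact le_csSup ⟨ℵ₀, hub⟩ ⟨s, s.finite_toSet.isFreeSet, by simp [hs]⟩

end Free

/-! ### Conclusion -/

theorem mainTheorem4 :
    ∃ (X : Type) (_ : TopologicalSpace X),
      (T2Space X ∧ TopologicalSpace.SeparableSpace X ∧ IsStronglyAntiUrysohn X ∧
        #X = 2 ^ 𝔠) ∧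
      T2Space (RegularOpenSpace X) ∧
      IsStronglyAntiUrysohn (RegularOpenSpace X) ∧
      freeSetNumber (RegularOpenSpace X) = ℵ₀ ∧
      spaceWeight (RegularOpenSpace X) ≤ 𝔠 ∧
      #(RegularOpenSpace X) = 2 ^ 𝔠 ∧
      spaceWeight (RegularOpenSpace X) ^ ℵ₀ < #(RegularOpenSpace X) := by
  obtain ⟨X, _, hT2, hsep, hX, hcard⟩ := exists_separable_stronglyAntiUrysohn
  have hcardR : #(RegularOpenSpace X) = 2 ^ 𝔠 := hcard
  have hw : spaceWeight (RegularOpenSpace X) ≤ 𝔠 := spaceWeight_regularOpenSpace_le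
  have : Infinite (RegularOpenSpace X) := by
    rw [Cardinal.infinite_iff, hcardR]
    exact Cardinal.aleph0_le_continuum.trans (Cardinal.cantor 𝔠).le
  refine ⟨X, inferInstance, ⟨hT2, hsep, hX, hcard⟩, inferInstance, hX.regularOpenSpace,
    hX.regularOpenSpace.freeSetNumber_eq, hw, hcardR, ?_⟩
  rw [hcardR]
  refine lt_of_le_of_lt ?_ (Cardinal.cantor 𝔠)
  exact (Cardinal.power_le_power_right hw).trans_eq Cardinal.continuum_power_aleph0
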